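/- For a group $G$ with a finite generating set $S$, let $\|g\|_S$ be the word length, let $d_S(g,h)=\|g^{-1}h\|_S$ be the word metric, and let $e$ be the identity of $G$. For $g\in G$ put $\iota_g\colon G\to\mathbb{R}$, $\iota_g(h)=d_S(g,h)-d_S(g,e)$. The horofunction boundary is $\partial(G,d_S)=\overline{\iota(G)}\setminus\iota(G)$, where the closure is taken in the space $\mathbb{R}^G$ of functions $G\to\mathbb{R}$ with the topology of pointwise convergence. The reduced horofunction boundary $\partial^r(G,d_S)$ is the quotient of $\partial(G,d_S)$ by the relation $\varphi\sim\psi$ if and only if $\varphi-\psi$ is bounded on $G$. An infinite geodesic is a sequence $(\gamma_n)_{n\ge 0}$ in $G$ with $d_S(\gamma_m,\gamma_n)=|m-n|$ for all $m,n$. A Busemann point of $\partial(G,d_S)$ is an element of the form $b_\gamma=\lim_{n\to\infty}\iota_{\gamma_n}$ for an infinite geodesic $\gamma$, and a Busemann point of $\partial^r(G,d_S)$ is the class of a Busemann point of $\partial(G,d_S)$. **Corollary.** Let $r\ge 2$ and $s\ge 3$ be integers. Let $\Gamma=F_r/\gamma_{s+1}(F_r)$ be the free nilpotent group of rank $r$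 and step $s$, where $F_r$ is the free group on $x_1,\dots,x_r$ and $\gamma_1(F_r)=F_r$, $\gamma_{i+1}(F_r)=[\gamma_i(F_r),F_r]$. Let $S=\{x_1^{\pm1},\dots,x_r^{\pm1}\}$ be its standard generating set. Then the reduced horofunction boundary $\partial^r(\Gamma,d_S)$ contains uncountably many Busemann points. -/

import Mathlib

open Filter Topology

/-- The word length of `g` with respect to `S`: the least length of a word in the elements of `S`
and their inverses that represents `g` (used for sets `S` that generate the group). -/
noncomputable def wordLength {G : Type*} [Group G] (S : Set G) (g : G) : ℕ :=
  sInf {n : ℕ | ∃ l : List G, (∀ a ∈ l, a ∈ S ∨ a⁻¹ ∈ S) ∧ l.prod = g ∧ l.length = n}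

/-- The (left-invariant) word metric `d_S(g, h) = ‖g⁻¹ h‖_S`. -/
noncomputable def wordDist {G : Type*} [Group G] (S : Set G) (g h : G) : ℕ :=
  wordLength S (g⁻¹ * h)

/-- The normalized distance function `h ↦ d_S(g, h) - d_S(g, 1)` of the point `g`. -/
noncomputable def normalizedDist {G : Type*} [Group G] (S : Set G) (g : G) : G → ℝ :=
  fun h => (wordDist S g h : ℝ) - (wordDist S g 1 : ℝ)

/-- The horofunction boundary `∂(G, d_S)`: the limits of the functions `normalizedDist S g` that are
not themselves of this form. The functions `G → ℝ` carry the topology of pointwise convergence,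
which is that of uniform convergence on compact sets as `(G, d_S)` is discrete. -/
def horoBoundary {G : Type*} [Group G] (S : Set G) : Set (G → ℝ) :=
  closure (Set.range (normalizedDist S)) \ Set.range (normalizedDist S)

/-- Infinite geodesics of `(G, d_S)`. -/
def IsGeodesicRay {G : Type*} [Group G] (S : Set G) (γ : ℕ → G) : Prop :=
  ∀ m n : ℕ, m ≤ n → wordDist S (γ m) (γ n) = n - m

/-- `φ` is a Busemann function: `φ = lim_n (d_S(γ n, ·) - d_S(γ n, 1))` for some infinite
geodesic `γ`. -/
def IsBusemann {G : Type*} [Group G] (S : Set G) (φ : G → ℝ) : Prop :=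
  ∃ γ : ℕ → G, IsGeodesicRay S γ ∧ Tendsto (fun n => normalizedDist S (γ n)) atTop (𝓝 φ)

/-- Two points of the horofunction boundary are equivalent if their difference is bounded. -/
def boundedDiffSetoid {G : Type*} [Group G] (S : Set G) : Setoid (horoBoundary S) where
  r φ ψ := ∃ C : ℝ, ∀ g : G, |φ.1 g - ψ.1 g| ≤ C
  iseqv :=
    { refl := fun φ => ⟨0, fun g => by simp⟩
      symm := fun ⟨C, hC⟩ => ⟨C, fun g => by rw [abs_sub_comm]; exact hC g⟩
      trans := fun ⟨C, hC⟩ ⟨D, hD⟩ =>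
        ⟨C + D, fun g => (abs_sub_le _ _ _).trans (add_le_add (hC g) (hD g))⟩ }

/-- The reduced horofunction boundary `∂ʳ(G, d_S)`: horofunctions up to bounded functions. -/
def ReducedHoroBoundary {G : Type*} [Group G] (S : Set G) : Type _ :=
  Quotient (boundedDiffSetoid S)

/-- The Busemann points of the reduced horofunction boundary: the classes of the points of the
horofunction boundary that are Busemann functions. -/
def reducedBusemannPoints {G : Type*} [Group G] (S : Set G) : Set (ReducedHoroBoundary S) :=
  {q | ∃ φ : horoBoundary S, IsBusemann S φ.1 ∧ Quotient.mk (boundedDiffSetoid S) φ = q}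

/-- The free nilpotent group of rank `r` and step `s`: the quotient `F_r / γ_{s+1}(F_r)`. The lower
central series of Mathlib starts with `lowerCentralSeries 0 = ⊤ = γ_1`. -/
abbrev FreeNilpotentGroup (r s : ℕ) : Type :=
  FreeGroup (Fin r) ⧸ (⊤ : Subgroup (FreeGroup (Fin r))).lowerCentralSeries s

/-- The standard generating set `{x_1^±, …, x_r^±}` of the free nilpotent group. -/
def freeNilpotentGenerators (r s : ℕ) : Set (FreeNilpotentGroup r s) :=
  {g | ∃ i : Fin r, g = QuotientGroup.mk (FreeGroup.of i) ∨
    g = (QuotientGroup.mk (FreeGroup.of i))⁻¹}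

/-! A word is read as a lattice path in ℤ²: `x_1` steps right, `x_2` steps up, the other generators
stay. A step up from `v` costs the square of the deviation of `v` from the line `x = μ y`, and its
inverse refunds that cost. The cost has degree 2 and every commutator lowers the degree, so
displacement and cost of a path depend only on the element of Γ once `s ≥ 3` (`freePathHom_eq_one`).

For each `μ ∈ [0, 1]` the staircase along the line has only positive letters, so it is a geodesic
ray, and it pays the least possible cost in every row it crosses. Suppose the Busemann functions for
`ν < μ` differ by a bounded amount. Then every point of the `μ`-ray is joined to a point of the
`ν`-ray by a word with boundedly many non-positive letters
(`exists_list_of_busemannFunction_sub_le`). Measured with slope `ν`, the `ν`-ray is optimal and the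
initial piece of the `μ`-ray is no better than optimal, so the joining word has excess at most 0.
But it returns from far right of the `ν`-line, which is costly, and a bounded number of inverse
letters cannot make up for this (`potential_le_excess`). So distinct slopes give distinct reduced
points. -/

/-! ### Word metrics and Busemann functions of geodesic rays -/

section WordMetric

variable {G : Type*} [Group G] {S : Set G}

theorem wordLength_prod_le {l : List G} (hl : ∀ a ∈ l, a ∈ S ∨ a⁻¹ ∈ S) :
    wordLength S l.prod ≤ l.length :=
  Nat.sInf_le ⟨l, hl, rfl, rfl⟩

theorem exists_list_length_eq_wordLength (hS : Subgroup.closure S = ⊤) (g : G) :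
    ∃ l : List G, (∀ a ∈ l, a ∈ S ∨ a⁻¹ ∈ S) ∧ l.prod = g ∧ l.length = wordLength S g := by
  have hg : g ∈ (Subgroup.closure S).toSubmonoid := by simp [hS]
  rw [Subgroup.closure_toSubmonoid] at hg
  obtain ⟨l, hl, h⟩ := Submonoid.exists_list_of_mem_closure hg
  exact Nat.sInf_mem (s := {n : ℕ | ∃ l : List G, (∀ a ∈ l, a ∈ S ∨ a⁻¹ ∈ S) ∧ l.prod = g ∧
    l.length = n}) ⟨l.length, l, hl, h, rfl⟩

theorem wordLength_mul_le (hS : Subgroup.closure S = ⊤) (g h : G) :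
    wordLength S (g * h) ≤ wordLength S g + wordLength S h := by
  obtain ⟨l, hl, rfl, hl'⟩ := exists_list_length_eq_wordLength hS g
  obtain ⟨k, hk, rfl, hk'⟩ := exists_list_length_eq_wordLength hS h
  rw [← hl', ← hk', ← List.prod_append, ← List.length_append]
  refine wordLength_prod_le fun a ha => ?_
  rcases List.mem_append.1 ha with h | h
  exacts [hl a h, hk a h]

theorem wordLength_inv_le (hS : Subgroup.closure S = ⊤) (g : G) :
    wordLength S g⁻¹ ≤ wordLength S g := by
  obtain ⟨l, hl, rfl, hl'⟩ := exists_list_length_eq_wordLength hS g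
  rw [← hl', List.prod_inv_reverse]
  refine (wordLength_prod_le fun a ha => ?_).trans (by simp)
  obtain ⟨b, hb, rfl⟩ := List.mem_map.1 (List.mem_reverse.1 ha)
  rw [inv_inv]
  exact (hl b hb).symm

theorem wordLength_inv (hS : Subgroup.closure S = ⊤) (g : G) :
    wordLength S g⁻¹ = wordLength S g :=
  (wordLength_inv_le hS g).antisymm (by simpa using wordLength_inv_le hS g⁻¹)

theorem wordDist_comm (hS : Subgroup.closure S = ⊤) (g h : G) :
    wordDist S g h = wordDist S h g := by
  rw [wordDist, ← wordLength_inv hS, wordDist, mul_inv_rev, inv_inv]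

theorem wordDist_triangle (hS : Subgroup.closure S = ⊤) (g h k : G) :
    wordDist S g k ≤ wordDist S g h + wordDist S h k := by
  have := wordLength_mul_le hS (g⁻¹ * h) (h⁻¹ * k)
  rwa [show g⁻¹ * h * (h⁻¹ * k) = g⁻¹ * k by group] at this

theorem neg_wordDist_le_normalizedDist (hS : Subgroup.closure S = ⊤) (g h : G) :
    -(wordDist S h 1 : ℝ) ≤ normalizedDist S g h := by
  have : (wordDist S g 1 : ℝ) ≤ wordDist S g h + wordDist S h 1 :=
    mod_cast wordDist_triangle hS g h 1
  rw [normalizedDist]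
  linarith

variable {γ : ℕ → G}

theorem IsGeodesicRay.normalizedDist_eq (hS : Subgroup.closure S = ⊤) (hγ : IsGeodesicRay S γ)
    (h1 : γ 0 = 1) (n : ℕ) (h : G) : normalizedDist S (γ n) h = wordDist S (γ n) h - n := by
  rw [normalizedDist, wordDist_comm hS (γ n) 1, ← h1, hγ 0 n n.zero_le, tsub_zero]

theorem IsGeodesicRay.antitone_normalizedDist (hS : Subgroup.closure S = ⊤)
    (hγ : IsGeodesicRay S γ) (h1 : γ 0 = 1) (h : G) :
    Antitone fun n => normalizedDist S (γ n) h := by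
  refine antitone_nat_of_succ_le fun n => ?_
  have h2 : (wordDist S (γ (n + 1)) h : ℝ) ≤ wordDist S (γ (n + 1)) (γ n) + wordDist S (γ n) h :=
    mod_cast wordDist_triangle hS _ _ _
  rw [wordDist_comm hS _ (γ n), hγ n (n + 1) n.le_succ, Nat.add_sub_cancel_left] at h2
  rw [hγ.normalizedDist_eq hS h1, hγ.normalizedDist_eq hS h1]
  push_cast at *
  linarith

/-- The Busemann function of a sequence, the pointwise infimum of the normalized distances. -/
noncomputable def busemannFunction (S : Set G) (γ : ℕ → G) (h : G) : ℝ :=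
  ⨅ n, normalizedDist S (γ n) h

theorem IsGeodesicRay.tendsto_busemannFunction (hS : Subgroup.closure S = ⊤)
    (hγ : IsGeodesicRay S γ) (h1 : γ 0 = 1) :
    Tendsto (fun n => normalizedDist S (γ n)) atTop (𝓝 (busemannFunction S γ)) := by
  refine tendsto_pi_nhds.2 fun h => ?_
  refine tendsto_atTop_ciInf (hγ.antitone_normalizedDist hS h1 h) ⟨-(wordDist S h 1 : ℝ), ?_⟩
  rintro _ ⟨n, rfl⟩
  exact neg_wordDist_le_normalizedDist hS _ _

theorem IsGeodesicRay.busemannFunction_apply_self (hS : Subgroup.closure S = ⊤)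
    (hγ : IsGeodesicRay S γ) (h1 : γ 0 = 1) (k : ℕ) : busemannFunction S γ (γ k) = -k := by
  refine tendsto_nhds_unique (tendsto_pi_nhds.1 (hγ.tendsto_busemannFunction hS h1) (γ k)) ?_
  refine tendsto_const_nhds.congr' ?_
  filter_upwards [eventually_ge_atTop k] with n hn
  rw [hγ.normalizedDist_eq hS h1, wordDist_comm hS, hγ k n hn, Nat.cast_sub hn]
  ring

/-- The Busemann function tends to `-∞` along its ray, while `normalizedDist S g` is bounded below
by `-d(g, 1)`. -/
theorem IsGeodesicRay.busemannFunction_mem_horoBoundary (hS : Subgroup.closure S = ⊤)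
    (hγ : IsGeodesicRay S γ) (h1 : γ 0 = 1) : busemannFunction S γ ∈ horoBoundary S := by
  refine ⟨mem_closure_of_tendsto (hγ.tendsto_busemannFunction hS h1)
    (Eventually.of_forall fun n => ⟨_, rfl⟩), ?_⟩
  rintro ⟨g, hg⟩
  have h2 := congrFun hg (γ (wordDist S g 1 + 1))
  rw [hγ.busemannFunction_apply_self hS h1, normalizedDist] at h2
  have h3 : (0 : ℝ) ≤ wordDist S g (γ (wordDist S g 1 + 1)) := Nat.cast_nonneg _
  push_cast at h2
  linarith

/-- If the Busemann functions of two geodesic rays from the identity differ by at most `C`, then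
the points of the first are joined to far points of the second by words that are at most `C + 1`
longer than they would be along a common geodesic. -/
theorem exists_list_of_busemannFunction_sub_le (hS : Subgroup.closure S = ⊤)
    (hγ : IsGeodesicRay S γ) (h1 : γ 0 = 1) {γ' : ℕ → G} (hγ' : IsGeodesicRay S γ')
    (h1' : γ' 0 = 1) {C : ℝ}
    (hC : ∀ g, |busemannFunction S γ' g - busemannFunction S γ g| ≤ C) (k : ℕ) :
    ∃ n : ℕ, ∃ l : List G, (∀ a ∈ l, a ∈ S ∨ a⁻¹ ∈ S) ∧ γ k * l.prod = γ' n ∧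
      (l.length : ℝ) + k ≤ n + (C + 1) := by
  have h2 := (abs_le.1 (hC (γ k))).2
  rw [hγ.busemannFunction_apply_self hS h1] at h2
  -- The slack 1 makes the inequality strict, so that some term of the infimum satisfies it.
  have h3 : busemannFunction S γ' (γ k) < C - k + 1 := by linarith
  obtain ⟨n, hn⟩ := exists_lt_of_ciInf_lt h3
  rw [hγ'.normalizedDist_eq hS h1', wordDist_comm hS] at hn
  obtain ⟨l, hl, hl', hl''⟩ := exists_list_length_eq_wordLength hS ((γ k)⁻¹ * γ' n)
  refine ⟨n, l, hl, by rw [hl']; group, ?_⟩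
  rw [hl'']
  change (wordDist S (γ k) (γ' n) : ℝ) + k ≤ _
  linarith

end WordMetric

/-! ### The group of displacements and costs, and its nilpotency on polynomial costs -/

/-- Pairs of a displacement in `ℤ²` and of a cost that depends on the starting point, with the
multiplication for which a product stands for the concatenation of two paths. -/
@[ext]
structure CostGroup where
  /-- The displacement of a path. -/
  disp : ℤ × ℤ
  /-- The cost of a path, as a function of its starting point. -/
  cost : ℤ × ℤ → ℝ

namespace CostGroup

open scoped commutatorElement

instance : Mul CostGroup := ⟨fun p q => ⟨p.disp + q.disp, fun v => p.cost v + q.cost (v + p.disp)⟩⟩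

instance : One CostGroup := ⟨⟨0, 0⟩⟩

instance : Inv CostGroup := ⟨fun p => ⟨-p.disp, fun v => -p.cost (v - p.disp)⟩⟩

@[simp] theorem disp_mul (p q : CostGroup) : (p * q).disp = p.disp + q.disp := rfl

@[simp] theorem cost_mul (p q : CostGroup) (v : ℤ × ℤ) :
    (p * q).cost v = p.cost v + q.cost (v + p.disp) := rfl

@[simp] theorem disp_one : (1 : CostGroup).disp = 0 := rfl

@[simp] theorem cost_one (v : ℤ × ℤ) : (1 : CostGroup).cost v = 0 := rfl

@[simp] theorem disp_inv (p : CostGroup) : p⁻¹.disp = -p.disp := rfl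

@[simp] theorem cost_inv (p : CostGroup) (v : ℤ × ℤ) : p⁻¹.cost v = -p.cost (v - p.disp) := rfl

instance : Group CostGroup :=
  Group.ofLeftAxioms
    (fun p q t => by ext <;> simp [add_assoc])
    (fun p => by ext <;> simp)
    (fun p => by ext <;> simp [sub_eq_add_neg])

/-- The functions on `ℤ²` all of whose `k`-fold differences vanish. -/
def polyLT : ℕ → AddSubgroup (ℤ × ℤ → ℝ)
  | 0 => ⊥
  | k + 1 =>
    { carrier := {f | ∀ w, (fun v => f (v + w) - f v) ∈ polyLT k}
      zero_mem' := fun w => by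
        convert (polyLT k).zero_mem using 1
        ext v; simp
      add_mem' := fun {f g} hf hg w => by
        convert (polyLT k).add_mem (hf w) (hg w) using 1
        ext v; simp; ring
      neg_mem' := fun {f} hf w => by
        convert (polyLT k).neg_mem (hf w) using 1
        ext v; simp; ring }

theorem mem_polyLT_zero {f : ℤ × ℤ → ℝ} : f ∈ polyLT 0 ↔ f = 0 := AddSubgroup.mem_bot

theorem comp_add_mem_polyLT {k : ℕ} {f : ℤ × ℤ → ℝ} (hf : f ∈ polyLT k) (w : ℤ × ℤ) :
    (fun v => f (v + w)) ∈ polyLT k := by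
  induction k generalizing f with
  | zero => rw [mem_polyLT_zero] at *; ext; simp [hf]
  | succ k ih =>
    intro w'
    convert ih (hf w') using 1
    ext v
    rw [add_right_comm]

/-- The elements whose cost has degree less than `k`. -/
def polySubgroup (k : ℕ) : Subgroup CostGroup where
  carrier := {p | p.cost ∈ polyLT k}
  one_mem' := (polyLT k).zero_mem
  mul_mem' {p q} hp hq := (polyLT k).add_mem hp (comp_add_mem_polyLT hq _)
  inv_mem' {p} hp := (polyLT k).neg_mem (by
    simpa only [sub_eq_add_neg] using comp_add_mem_polyLT hp (-p.disp))

/-- The elements without displacement whose cost has degree less than `k`. -/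
def closedSubgroup (k : ℕ) : Subgroup CostGroup where
  carrier := {p | p.disp = 0 ∧ p.cost ∈ polyLT k}
  one_mem' := ⟨rfl, (polyLT k).zero_mem⟩
  mul_mem' {p q} hp hq := ⟨by simp [hp.1, hq.1], (polySubgroup k).mul_mem hp.2 hq.2⟩
  inv_mem' {p} hp := ⟨by simp [hp.1], (polySubgroup k).inv_mem hp.2⟩

/-- Going around the commutator, the displacements cancel and the two costs survive only through
their differences along `p.disp` and `q.disp`. -/
theorem commutatorElement_mem_closedSubgroup {k : ℕ} {p q : CostGroup}
    (hp : p ∈ polySubgroup (k + 1)) (hq : q ∈ polySubgroup (k + 1)) :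
    ⁅p, q⁆ ∈ closedSubgroup k := by
  refine ⟨by simp [commutatorElement_def], ?_⟩
  convert (polyLT k).sub_mem (hq p.disp) (hp q.disp) using 1
  ext v
  have h1 : v + p.disp + q.disp + -p.disp - q.disp = v := by abel
  have h2 : v + p.disp + q.disp - p.disp = v + q.disp := by abel
  simp only [commutatorElement_def, cost_mul, cost_inv, disp_mul, disp_inv, Pi.sub_apply,
    ← add_assoc, h1, h2]
  ring

/-- As `p` has no displacement, the cost of `q` cancels entirely and may be arbitrary. -/
theorem commutatorElement_mem_closedSubgroup_of_mem {k : ℕ} {p q : CostGroup}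
    (hp : p ∈ closedSubgroup (k + 1)) : ⁅p, q⁆ ∈ closedSubgroup k := by
  refine ⟨by simp [commutatorElement_def], ?_⟩
  convert (polyLT k).neg_mem (hp.2 q.disp) using 1
  ext v
  have h1 : v + q.disp - q.disp = v := by abel
  simp only [commutatorElement_def, cost_mul, cost_inv, disp_mul, disp_inv, Pi.neg_apply,
    hp.1, neg_zero, add_zero, zero_add, sub_zero, h1]
  ring

theorem map_lowerCentralSeries_succ_le {F : Type*} [Group F] (f : F →* CostGroup) {j k n : ℕ}
    (hf : ∀ x, f x ∈ polySubgroup (k + 1)) (hn : n + j = k) :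
    (⊤ : Subgroup F).lowerCentralSeries (n + 1) ≤ (closedSubgroup j).comap f := by
  induction n generalizing j with
  | zero =>
    obtain rfl : j = k := by omega
    refine Subgroup.commutator_le.2 fun p _ q _ => ?_
    rw [Subgroup.mem_comap, map_commutatorElement]
    exact commutatorElement_mem_closedSubgroup (hf p) (hf q)
  | succ n ih =>
    refine Subgroup.commutator_le.2 fun p hp q _ => ?_
    rw [Subgroup.mem_comap, map_commutatorElement]
    exact commutatorElement_mem_closedSubgroup_of_mem
      (ih (j := j + 1) (by omega) hp)

theorem eq_one_of_mem_closedSubgroup_zero {p : CostGroup} (hp : p ∈ closedSubgroup 0) : p = 1 := by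
  ext1
  · exact hp.1
  · exact mem_polyLT_zero.1 hp.2

/-- The step to the right, without cost. -/
def stepRight : CostGroup := ⟨(1, 0), 0⟩

/-- The step upwards, whose cost is the square of the deviation from the line `x = μ y`. -/
def stepUp (μ : ℝ) : CostGroup := ⟨(0, 1), fun v => (v.1 - μ * v.2) ^ 2⟩

theorem stepRight_mem_polySubgroup (k : ℕ) : stepRight ∈ polySubgroup k := (polyLT k).zero_mem

theorem stepUp_mem_polySubgroup (μ : ℝ) : stepUp μ ∈ polySubgroup 3 := by
  intro w₁ w₂ w₃
  rw [mem_polyLT_zero]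
  ext v
  simp only [stepUp, Prod.fst_add, Prod.snd_add, Int.cast_add, Pi.zero_apply]
  ring

end CostGroup

/-! ### One-step inequalities for the potential -/

section Potential

/-- The square of the part of `u` above `R`. -/
def sqAbove (R u : ℝ) : ℝ := max 0 (u - R) ^ 2

theorem sqAbove_nonneg (R u : ℝ) : 0 ≤ sqAbove R u := sq_nonneg _

theorem sqAbove_of_le {R u : ℝ} (h : u ≤ R) : sqAbove R u = 0 := by
  rw [sqAbove, max_eq_left (by linarith), zero_pow two_ne_zero]

theorem sqAbove_of_ge {R u : ℝ} (h : R ≤ u) : sqAbove R u = (u - R) ^ 2 := by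
  rw [sqAbove, max_eq_right (by linarith)]

theorem sqAbove_mono (R : ℝ) : Monotone (sqAbove R) := fun u v h =>
  pow_le_pow_left₀ (le_max_left _ _) (max_le_max_left _ (by linarith)) 2

theorem sqAbove_sub_le {R u μ : ℝ} (hμ1 : μ ≤ 1) (hu : R ≤ u) :
    sqAbove R u - sqAbove R (u - μ) ≤ 2 * (u - R) := by
  rw [sqAbove_of_ge hu]
  rcases le_total R (u - μ) with h | h
  · rw [sqAbove_of_ge h]
    nlinarith [mul_nonneg (sub_nonneg.2 hu) (sub_nonneg.2 hμ1)]
  · rw [sqAbove_of_le h]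
    nlinarith

variable {A B R q p u μ c : ℝ}

/-- Beyond the threshold the potential changes at a rate linear in `|u|`, with coefficient at most
`2 * A`; the quadratic cost dominates it because `(|u| - A) ^ 2 ≥ 0`. -/
theorem potential_le_stepUp (hA : 2 ≤ A) (hq : 0 ≤ q) (hqA : q ≤ A)
    (hp : 0 ≤ p) (hpA : p ≤ A) (hμ : 0 ≤ μ) (hμ1 : μ ≤ 1) (hc : 0 ≤ c) (hcu : u ^ 2 - 1 / 4 ≤ c) :
    q * sqAbove (A + 1) u - p * sqAbove (A + 1) (-u) ≤
      c + (q * sqAbove (A + 1) (u - μ) - p * sqAbove (A + 1) (-(u - μ))) := by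
  rcases le_total (A + 1) u with h | h
  · rw [sqAbove_of_le (u := -u) (by linarith), sqAbove_of_le (u := -(u - μ)) (by linarith)]
    have h1 := mul_le_mul_of_nonneg_left (sqAbove_sub_le hμ1 h) hq
    have h2 : q * (2 * (u - (A + 1))) ≤ A * (2 * (u - (A + 1))) :=
      mul_le_mul_of_nonneg_right hqA (by linarith)
    nlinarith [sq_nonneg (u - A)]
  rw [sqAbove_of_le h, sqAbove_of_le (u := u - μ) (by linarith)]
  -- The split is at `A`, not `A + 1`: the step may carry `-u` across the threshold, by at most `μ ≤
  -- 1`.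
  rcases le_total A (-u) with h' | h'
  · suffices p * (sqAbove (A + 1) (-(u - μ)) - sqAbove (A + 1) (-u)) ≤ c by linarith
    rcases le_total (A + 1) (-u) with h'' | h''
    · rw [sqAbove_of_ge h'', sqAbove_of_ge (by linarith)]
      have h1 : (-(u - μ) - (A + 1)) ^ 2 - (-u - (A + 1)) ^ 2 ≤ 2 * (-u - (A + 1)) + 1 := by
        nlinarith
      have h2 := mul_le_mul_of_nonneg_left h1 hp
      have h3 : p * (2 * (-u - (A + 1)) + 1) ≤ A * (2 * (-u - (A + 1)) + 1) :=
        mul_le_mul_of_nonneg_right hpA (by linarith)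
      nlinarith [sq_nonneg (u + A)]
    · rw [sqAbove_of_le h'', sub_zero]
      have h1 : sqAbove (A + 1) (-(u - μ)) ≤ 1 := by
        refine (sqAbove_mono (A + 1) (show -(u - μ) ≤ A + 2 by linarith)).trans ?_
        rw [sqAbove_of_ge (by linarith)]
        nlinarith
      have h2 := mul_le_mul_of_nonneg_left h1 hp
      nlinarith
  · rw [sqAbove_of_le (u := -u) (by linarith), sqAbove_of_le (by linarith)]
    linarith

/-- A step to the left is free but changes the potential linearly in `|u|`. Using up one
non-positive letter raises `q` and lowers `p` by 2, a quadratic gain that absorbs this up to a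
constant. -/
theorem potential_le_stepLeft (hq : 0 ≤ q) (hqA : q + 2 ≤ A) (hp : 0 ≤ p) (hpA : p + 2 ≤ A) :
    q * sqAbove R u - (p + 2) * sqAbove R (-u) ≤
      2 * A ^ 2 + ((q + 2) * sqAbove R (u - 1) - p * sqAbove R (-(u - 1))) := by
  have h1 : q * sqAbove R u ≤ A ^ 2 + (q + 2) * sqAbove R (u - 1) := by
    rcases le_total u (R + 1) with h | h
    · have h2 := sqAbove_mono R h
      rw [sqAbove_of_ge (u := R + 1) (by linarith), add_sub_cancel_left, one_pow] at h2
      have h3 := mul_le_mul_of_nonneg_left h2 hq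
      have h4 := mul_nonneg (show 0 ≤ q + 2 by linarith) (sqAbove_nonneg R (u - 1))
      nlinarith
    · rw [sqAbove_of_ge (by linarith), sqAbove_of_ge (by linarith)]
      obtain ⟨t, ht⟩ : ∃ t, t = u - R := ⟨_, rfl⟩
      rw [show u - 1 - R = t - 1 by rw [ht]; ring, ← ht]
      -- `(q + 2) * (t - 1) ^ 2 - q * t ^ 2` is minimal at `t = (q + 2) / 2`.
      nlinarith [sq_nonneg (2 * t - (q + 2))]
  have h2 : p * sqAbove R (-(u - 1)) ≤ A ^ 2 + (p + 2) * sqAbove R (-u) := by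
    rcases le_total (-u) R with h | h
    · have h2 := sqAbove_mono R (show -(u - 1) ≤ R + 1 by linarith)
      rw [sqAbove_of_ge (u := R + 1) (by linarith), add_sub_cancel_left, one_pow] at h2
      have h3 := mul_le_mul_of_nonneg_left h2 hp
      have h4 := mul_nonneg (show 0 ≤ p + 2 by linarith) (sqAbove_nonneg R (-u))
      nlinarith
    · rw [sqAbove_of_ge (by linarith), sqAbove_of_ge (by linarith)]
      obtain ⟨t, ht⟩ : ∃ t, t = -u - R := ⟨_, rfl⟩
      rw [show -(u - 1) - R = t + 1 by rw [ht]; ring, ← ht]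
      nlinarith [sq_nonneg (2 * t - p)]
  linarith

/-- The refund `(u + μ) ^ 2` is paid for by the shift of both coefficients by 2, on whichever side
of the line the step ends. -/
theorem potential_le_stepDown (hq : 0 ≤ q) (hp : 0 ≤ p) (hμ : 0 ≤ μ) (hcu : -(u + μ) ^ 2 ≤ c) :
    q * sqAbove R u - (p + 2) * sqAbove R (-u) ≤
      2 * R ^ 2 + (c + ((q + 2) * sqAbove R (u + μ) - p * sqAbove R (-(u + μ)))) := by
  have h1 := mul_le_mul_of_nonneg_left (sqAbove_mono R (show u ≤ u + μ by linarith)) hq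
  have h2 := mul_le_mul_of_nonneg_left (sqAbove_mono R (show -(u + μ) ≤ -u by linarith))
    (show 0 ≤ p + 2 by linarith)
  have h3 : (u + μ) ^ 2 ≤ 2 * R ^ 2 + 2 * sqAbove R (u + μ) + 2 * sqAbove R (-(u + μ)) := by
    have h4 := sqAbove_nonneg R (u + μ)
    have h5 := sqAbove_nonneg R (-(u + μ))
    rcases le_total R (u + μ) with h | h
    · rw [sqAbove_of_ge h]
      nlinarith [sq_nonneg (u + μ - 2 * R)]
    rcases le_total R (-(u + μ)) with h' | h'
    · rw [sqAbove_of_ge h']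
      nlinarith [sq_nonneg (-(u + μ) - 2 * R)]
    · nlinarith
  linarith

end Potential

/-! ### Paths with few non-positive letters and their excess -/

namespace CostGroup

/-- The letters of paths: the two positive steps, their inverses, and the empty step. -/
def IsLetter (μ : ℝ) (p : CostGroup) : Prop :=
  p = stepRight ∨ p = stepUp μ ∨ p = stepRight⁻¹ ∨ p = (stepUp μ)⁻¹ ∨ p = 1

/-- The signed number of steps of a path. -/
def height (p : CostGroup) : ℤ := p.disp.1 + p.disp.2

theorem height_mul (p q : CostGroup) : height (p * q) = height p + height q := by
  simp only [height, disp_mul, Prod.fst_add, Prod.snd_add]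
  ring

theorem height_one : height 1 = 0 := rfl

theorem IsLetter.height_le {μ : ℝ} {p : CostGroup} (hp : IsLetter μ p) : height p ≤ 1 := by
  rcases hp with rfl | rfl | rfl | rfl | rfl <;>
    simp [height, stepRight, stepUp, disp_inv]

theorem height_prod_le {μ : ℝ} {l : List CostGroup} (hl : ∀ p ∈ l, IsLetter μ p) :
    height l.prod ≤ l.length := by
  induction l with
  | nil => simp [height_one]
  | cons p l ih =>
    rw [List.prod_cons, height_mul, List.length_cons]
    have h1 := (hl p (by simp)).height_le
    have h2 := ih fun q hq => hl q (by simp [hq])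
    push_cast
    linarith

/-- The deviation of a point from the line `x = μ y`. -/
def deviation (μ : ℝ) (v : ℤ × ℤ) : ℝ := v.1 - μ * v.2

/-- The excess of the cost of a path over the minimal cost `M` of a monotone path that crosses the
same rows. -/
def excess (M : ℤ → ℝ) (p : CostGroup) (v : ℤ × ℤ) : ℝ :=
  p.cost v - (M (v + p.disp).2 - M v.2)

theorem excess_mul (M : ℤ → ℝ) (p q : CostGroup) (v : ℤ × ℤ) :
    excess M (p * q) v = excess M p v + excess M q (v + p.disp) := by
  simp only [excess, cost_mul, disp_mul, ← add_assoc]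
  ring

theorem excess_one (M : ℤ → ℝ) (v : ℤ × ℤ) : excess M 1 v = 0 := by simp [excess]

/-- `M` sums, row by row, lower bounds in `[0, 1/4]` of the costs of the upward steps. -/
structure IsRowBound (μ : ℝ) (M : ℤ → ℝ) : Prop where
  le_succ : ∀ y, M y ≤ M (y + 1)
  sub_le : ∀ y, M (y + 1) - M y ≤ 1 / 4
  sub_le_sq : ∀ x y : ℤ, M (y + 1) - M y ≤ (x - μ * y) ^ 2

/-- A path with at most `e ≤ E` letters that are not positive steps, and which ends close to the
line `x = μ y` or to its left, has an excess that is bounded below, and large if the path starts far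
to the right of this line. -/
theorem potential_le_excess {μ : ℝ} {M : ℤ → ℝ} (hμ : 0 ≤ μ) (hμ1 : μ ≤ 1) (hM : IsRowBound μ M)
    {E : ℕ} {A : ℝ} (hA : A = 2 * (E + 1)) {l : List CostGroup} (hl : ∀ p ∈ l, IsLetter μ p)
    {e : ℕ} (he : e ≤ E) (hle : (l.length : ℤ) ≤ height l.prod + e) {v : ℤ × ℤ}
    (hv : deviation μ (v + l.prod.disp) ≤ A + 1) :
    2 * (E + 1 - e) * sqAbove (A + 1) (deviation μ v) - 2 * e * sqAbove (A + 1) (-deviation μ v) -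
      e * (2 * A ^ 2 + 2 * (A + 1) ^ 2) ≤ excess M l.prod v := by
  have hE : (0 : ℝ) ≤ E := E.cast_nonneg
  -- The coefficients `2 * (E + 1 - e)` and `2 * e` sum to `A`. Each non-positive letter shifts them
  -- by 2 and uses up one of the `e` constants, which is the sum of those for a left and a down
  -- step.
  induction l generalizing e v with
  | nil =>
    rw [List.prod_nil, disp_one, add_zero] at hv
    rw [List.prod_nil, excess_one, sqAbove_of_le hv]
    have := sqAbove_nonneg (A + 1) (-deviation μ v)
    have : 0 ≤ (e : ℝ) * (2 * A ^ 2 + 2 * (A + 1) ^ 2) := by positivity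
    have : 0 ≤ 2 * (e : ℝ) * sqAbove (A + 1) (-deviation μ v) := by positivity
    linarith
  | cons p l ih =>
    have hl' : ∀ q ∈ l, IsLetter μ q := fun q hq => hl q (by simp [hq])
    have hlen := height_prod_le hl'
    have heE : (e : ℝ) ≤ E := mod_cast he
    have he0 : (0 : ℝ) ≤ e := e.cast_nonneg
    rw [List.prod_cons, height_mul, List.length_cons] at hle
    rw [List.prod_cons, disp_mul, ← add_assoc] at hv
    rw [List.prod_cons, excess_mul]
    push_cast at hle
    obtain hp | ⟨hp, e', rfl, hle'⟩ : ((p = stepRight ∨ p = stepUp μ) ∧ height p = 1) ∨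
        (p = stepRight⁻¹ ∨ p = (stepUp μ)⁻¹ ∨ p = 1) ∧
          ∃ e', e = e' + 1 ∧ (l.length : ℤ) ≤ height l.prod + e' := by
      have h1 : height p ≤ 0 → ∃ e', e = e' + 1 ∧ (l.length : ℤ) ≤ height l.prod + e' :=
        fun h => ⟨e - 1, by omega, by omega⟩
      rcases hl p (by simp) with rfl | rfl | rfl | rfl | rfl
      · exact .inl ⟨.inl rfl, rfl⟩
      · exact .inl ⟨.inr rfl, rfl⟩
      · exact .inr ⟨.inl rfl, h1 (by decide)⟩
      · exact .inr ⟨.inr (.inl rfl), h1 (by simp [height, stepUp, disp_inv])⟩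
      · exact .inr ⟨.inr (.inr rfl), h1 le_rfl⟩
    · obtain ⟨rfl | rfl, hp1⟩ := hp
      · have h1 := ih hl' he (by linarith) hv
        have h2 : deviation μ (v + stepRight.disp) = deviation μ v + 1 := by
          simp [deviation, stepRight]; ring
        have h3 : excess M stepRight v = 0 := by simp [excess, stepRight]
        rw [h2] at h1
        have h4 := mul_le_mul_of_nonneg_left (sqAbove_mono (A + 1)
          (show deviation μ v ≤ deviation μ v + 1 by linarith))
          (show 0 ≤ 2 * ((E : ℝ) + 1 - e) by linarith)
        have h5 := mul_le_mul_of_nonneg_left (sqAbove_mono (A + 1)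
          (show -(deviation μ v + 1) ≤ -deviation μ v by linarith))
          (show 0 ≤ 2 * (e : ℝ) by linarith)
        linarith
      · have h1 := ih hl' he (by linarith) hv
        have h2 : deviation μ (v + (stepUp μ).disp) = deviation μ v - μ := by
          simp [deviation, stepUp]; ring
        have h3 : excess M (stepUp μ) v = deviation μ v ^ 2 - (M (v.2 + 1) - M v.2) := by
          simp [excess, stepUp, deviation]
        rw [h2] at h1
        have h4 := potential_le_stepUp (A := A) (q := 2 * ((E : ℝ) + 1 - e)) (p := 2 * (e : ℝ))
          (u := deviation μ v) (c := excess M (stepUp μ) v)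
          (by linarith) (by linarith) (by linarith) (by linarith) (by linarith) hμ hμ1
          (by rw [h3]; exact sub_nonneg.2 (hM.sub_le_sq v.1 v.2))
          (by rw [h3]; linarith [hM.sub_le v.2])
        linarith
    · have h1 := ih hl' (by omega) hle' hv
      push_cast at heE ⊢
      have he0' : (0 : ℝ) ≤ e' := e'.cast_nonneg
      have hA2 : 0 ≤ A ^ 2 := sq_nonneg _
      have hA2' : 0 ≤ (A + 1) ^ 2 := sq_nonneg _
      have hmono : 2 * (E + 1 - (e' + 1)) * sqAbove (A + 1) (deviation μ v) -
          2 * (e' + 1) * sqAbove (A + 1) (-deviation μ v) ≤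
          2 * (E + 1 - e') * sqAbove (A + 1) (deviation μ v) -
          2 * e' * sqAbove (A + 1) (-deviation μ v) := by
        linarith [sqAbove_nonneg (A + 1) (deviation μ v), sqAbove_nonneg (A + 1) (-deviation μ v)]
      rcases hp with rfl | rfl | rfl
      · have h2 : deviation μ (v + stepRight⁻¹.disp) = deviation μ v - 1 := by
          simp [deviation, stepRight]; ring
        have h3 : excess M stepRight⁻¹ v = 0 := by simp [excess, stepRight]
        rw [h2] at h1
        have h4 := potential_le_stepLeft (A := A) (R := A + 1) (q := 2 * ((E : ℝ) + 1 - (e' + 1)))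
          (p := 2 * (e' : ℝ)) (u := deviation μ v)
          (by linarith) (by linarith) (by linarith) (by linarith)
        linarith
      · have h2 : deviation μ (v + (stepUp μ)⁻¹.disp) = deviation μ v + μ := by
          simp [deviation, stepUp]; ring
        have h3 : -(deviation μ v + μ) ^ 2 ≤ excess M (stepUp μ)⁻¹ v := by
          have h5 := hM.le_succ (v.2 - 1)
          rw [sub_add_cancel] at h5
          have h6 : excess M (stepUp μ)⁻¹ v =
              -(deviation μ v + μ) ^ 2 - (M (v.2 - 1) - M v.2) := by
            simp [excess, stepUp, deviation, ← sub_eq_add_neg]; ring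
          linarith
        rw [h2] at h1
        have h4 := potential_le_stepDown (R := A + 1) (q := 2 * ((E : ℝ) + 1 - (e' + 1)))
          (p := 2 * (e' : ℝ)) (u := deviation μ v) (by linarith) (by linarith) hμ h3
        linarith
      · rw [disp_one, add_zero] at h1 ⊢
        rw [excess_one]
        linarith

end CostGroup

/-! ### Staircases along lines -/

section Staircase

/-- The staircase that follows the line `x = μ y`: it goes up whenever it is as close as possible to
the line in its row. -/
noncomputable def staircase (μ : ℝ) : ℕ → ℤ × ℤ
  | 0 => 0
  | n + 1 => staircase μ n +
      if (staircase μ n).1 = round (μ * (staircase μ n).2) then (0, 1) else (1, 0)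

/-- The products of the letters of the staircase, `a` for a step to the right and `b` for a step
upwards. -/
noncomputable def staircaseProd {G : Type*} [Group G] (μ : ℝ) (a b : G) : ℕ → G
  | 0 => 1
  | n + 1 => staircaseProd μ a b n *
      if (staircase μ n).1 = round (μ * (staircase μ n).2) then b else a

theorem map_staircaseProd {G H : Type*} [Group G] [Group H] (f : G →* H) (μ : ℝ) (a b : G) (n : ℕ) :
    f (staircaseProd μ a b n) = staircaseProd μ (f a) (f b) n := by
  induction n with
  | zero => exact map_one f
  | succ n ih => rw [staircaseProd, staircaseProd, map_mul, ih, apply_ite f]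

variable {μ : ℝ}

theorem staircase_fst_add_snd (n : ℕ) : (staircase μ n).1 + (staircase μ n).2 = n := by
  induction n with
  | zero => simp [staircase]
  | succ n ih =>
    rw [staircase]
    push_cast
    rw [← ih]
    split_ifs <;> simp <;> ring

theorem staircase_snd_nonneg (n : ℕ) : 0 ≤ (staircase μ n).2 := by
  induction n with
  | zero => simp [staircase]
  | succ n ih =>
    rw [staircase]
    split_ifs <;> simp <;> omega

theorem staircase_fst_le (hμ : 0 ≤ μ) (n : ℕ) :
    (staircase μ n).1 ≤ round (μ * (staircase μ n).2) := by
  induction n with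
  | zero => simp [staircase]
  | succ n ih =>
    rw [staircase]
    split_ifs with h
    · rw [Prod.fst_add, Prod.snd_add, add_zero, h, round_eq, round_eq]
      refine Int.floor_mono ?_
      push_cast
      linarith
    · simp only [Prod.fst_add, Prod.snd_add, add_zero]
      exact Int.add_one_le_of_lt (lt_of_le_of_ne ih h)

theorem deviation_staircase_le (hμ : 0 ≤ μ) (n : ℕ) :
    CostGroup.deviation μ (staircase μ n) ≤ 1 / 2 := by
  have h1 : ((staircase μ n).1 : ℝ) ≤ round (μ * (staircase μ n).2) :=
    mod_cast staircase_fst_le hμ n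
  have h2 := (abs_le.1 (abs_sub_round (μ * ((staircase μ n).2 : ℝ)))).1
  rw [CostGroup.deviation]
  linarith

theorem le_deviation_staircase (hμ1 : μ ≤ 1) (n : ℕ) :
    -(3 / 2) ≤ CostGroup.deviation μ (staircase μ n) := by
  induction n with
  | zero => simp [staircase, CostGroup.deviation]; norm_num
  | succ n ih =>
    rw [CostGroup.deviation] at *
    rw [staircase]
    split_ifs with h
    · have h2 := (abs_le.1 (abs_sub_round (μ * ((staircase μ n).2 : ℝ)))).2
      rw [← h] at h2
      simp only [Prod.fst_add, Prod.snd_add, add_zero]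
      push_cast
      linarith
    · simp only [Prod.fst_add, Prod.snd_add, add_zero]
      push_cast
      linarith

/-- Changing the slope adds `(μ - ν) * y` to the deviation, and `y` is about `n / 2` or more because
`x ≤ y + 1 / 2`. -/
theorem le_deviation_staircase_of_lt (hμ : 0 ≤ μ) (hμ1 : μ ≤ 1) {ν : ℝ} (hν : ν < μ) (n : ℕ) :
    (μ - ν) * ((n - 1 / 2) / 2) - 3 / 2 ≤ CostGroup.deviation ν (staircase μ n) := by
  have h1 := deviation_staircase_le hμ n
  have h2 := le_deviation_staircase hμ1 n
  have h3 : ((staircase μ n).1 : ℝ) + (staircase μ n).2 = n := mod_cast staircase_fst_add_snd n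
  have h4 : (0 : ℝ) ≤ (staircase μ n).2 := mod_cast staircase_snd_nonneg n
  rw [CostGroup.deviation] at *
  have h5 : ((n : ℝ) - 1 / 2) / 2 ≤ (staircase μ n).2 := by nlinarith
  have h6 := mul_le_mul_of_nonneg_left h5 (sub_nonneg.2 hν.le)
  linarith

end Staircase

/-! ### Optimality of staircases, and the path homomorphism of the free nilpotent group -/

namespace CostGroup

/-- The minimal total cost of upward steps in the rows between `0` and `y`. -/
noncomputable def rowBound (μ : ℝ) (y : ℤ) : ℝ :=
  ∑ i ∈ Finset.range y.toNat, (round (μ * i) - μ * i) ^ 2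

theorem rowBound_add_one {μ : ℝ} {y : ℤ} (hy : 0 ≤ y) :
    rowBound μ (y + 1) - rowBound μ y = (round (μ * y) - μ * y) ^ 2 := by
  lift y to ℕ using hy
  rw [rowBound, rowBound, show ((y : ℤ) + 1).toNat = y + 1 by omega, Int.toNat_natCast,
    Finset.sum_range_succ, add_sub_cancel_left, Int.cast_natCast]

theorem isRowBound_rowBound (μ : ℝ) : IsRowBound μ (rowBound μ) := by
  have h : ∀ y : ℤ, y < 0 → rowBound μ (y + 1) - rowBound μ y = 0 := fun y hy => by
    rw [rowBound, rowBound, show (y + 1).toNat = 0 by omega, show y.toNat = 0 by omega, sub_self]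
  refine ⟨fun y => ?_, fun y => ?_, fun x y => ?_⟩ <;> rcases lt_or_ge y 0 with hy | hy
  · exact (sub_eq_zero.1 (h y hy)).ge
  · exact sub_nonneg.1 ((sq_nonneg _).trans (rowBound_add_one hy).ge)
  · rw [h y hy]
    norm_num
  · rw [rowBound_add_one hy, ← sq_abs, abs_sub_comm]
    nlinarith [abs_sub_round (μ * (y : ℝ)), abs_nonneg (μ * (y : ℝ) - round (μ * (y : ℝ)))]
  · rw [h y hy]
    exact sq_nonneg _
  · rw [rowBound_add_one hy, sq_le_sq, abs_sub_comm, abs_sub_comm (x : ℝ)]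
    exact round_le _ _

theorem disp_staircaseProd (μ ν : ℝ) (n : ℕ) :
    (staircaseProd μ stepRight (stepUp ν) n).disp = staircase μ n := by
  induction n with
  | zero => rfl
  | succ n ih =>
    rw [staircaseProd, staircase, disp_mul, ih]
    split_ifs <;> rfl

theorem excess_stepRight (M : ℤ → ℝ) (v : ℤ × ℤ) : excess M stepRight v = 0 := by
  simp [excess, stepRight]

theorem excess_stepUp (M : ℤ → ℝ) (μ : ℝ) (v : ℤ × ℤ) :
    excess M (stepUp μ) v = (v.1 - μ * v.2) ^ 2 - (M (v.2 + 1) - M v.2) := by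
  simp [excess, stepUp]

theorem excess_staircaseProd_nonneg {ν : ℝ} {M : ℤ → ℝ} (hM : IsRowBound ν M) (μ : ℝ) (n : ℕ) :
    0 ≤ excess M (staircaseProd μ stepRight (stepUp ν) n) 0 := by
  induction n with
  | zero => exact (excess_one M 0).ge
  | succ n ih =>
    rw [staircaseProd, excess_mul]
    refine add_nonneg ih ?_
    split_ifs
    · rw [excess_stepUp]
      exact sub_nonneg.2 (hM.sub_le_sq _ _)
    · rw [excess_stepRight]

/-- The staircase leaves row `y` at `x = round (μ * y)`, where the cost of going up is minimal. -/
theorem excess_staircaseProd_self (μ : ℝ) (n : ℕ) :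
    excess (rowBound μ) (staircaseProd μ stepRight (stepUp μ) n) 0 = 0 := by
  induction n with
  | zero => exact excess_one _ 0
  | succ n ih =>
    rw [staircaseProd, excess_mul, ih, zero_add, zero_add, disp_staircaseProd]
    split_ifs with h
    · rw [excess_stepUp, rowBound_add_one (staircase_snd_nonneg n), h, sub_self]
    · rw [excess_stepRight]

theorem height_staircaseProd (μ ν : ℝ) (n : ℕ) :
    height (staircaseProd μ stepRight (stepUp ν) n) = n := by
  rw [height, disp_staircaseProd, staircase_fst_add_snd]

theorem IsLetter.inv {μ : ℝ} {p : CostGroup} (hp : IsLetter μ p) : IsLetter μ p⁻¹ := by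
  rcases hp with rfl | rfl | rfl | rfl | rfl <;> simp [IsLetter]

/-- The first generator steps to the right, the second one upwards, and the others stay. -/
noncomputable def freePathHom (r : ℕ) (μ : ℝ) : FreeGroup (Fin r) →* CostGroup :=
  FreeGroup.lift fun i => if i.val = 0 then stepRight else if i.val = 1 then stepUp μ else 1

theorem freePathHom_mem_polySubgroup (r : ℕ) (μ : ℝ) (g : FreeGroup (Fin r)) :
    freePathHom r μ g ∈ polySubgroup 3 := by
  refine (FreeGroup.range_lift_le (s := polySubgroup 3) ?_) ⟨g, rfl⟩
  rintro _ ⟨i, rfl⟩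
  dsimp only
  split_ifs
  exacts [stepRight_mem_polySubgroup 3, stepUp_mem_polySubgroup μ, (polySubgroup 3).one_mem]

theorem freePathHom_eq_one {r s : ℕ} (hs : 3 ≤ s) (μ : ℝ) {g : FreeGroup (Fin r)}
    (hg : g ∈ (⊤ : Subgroup (FreeGroup (Fin r))).lowerCentralSeries s) : freePathHom r μ g = 1 :=
  eq_one_of_mem_closedSubgroup_zero
    -- Three commutators exhaust degree less than 3: `lowerCentralSeries 3`, which is `γ_4`, dies.
    (map_lowerCentralSeries_succ_le (freePathHom r μ) (freePathHom_mem_polySubgroup r μ)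
      (n := 2) rfl (Subgroup.lowerCentralSeries_antitone _ hs hg))

/-- The path invariants of the elements of the free nilpotent groups of step at least `3`. -/
noncomputable def pathHom (r : ℕ) {s : ℕ} (hs : 3 ≤ s) (μ : ℝ) :
    FreeNilpotentGroup r s →* CostGroup :=
  QuotientGroup.lift _ (freePathHom r μ) fun _ hg => freePathHom_eq_one hs μ hg

theorem pathHom_mk {r s : ℕ} (hs : 3 ≤ s) (μ : ℝ) (g : FreeGroup (Fin r)) :
    pathHom r hs μ (QuotientGroup.mk g) = freePathHom r μ g := rfl

theorem isLetter_pathHom {r s : ℕ} (hs : 3 ≤ s) (μ : ℝ) {g : FreeNilpotentGroup r s}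
    (hg : g ∈ freeNilpotentGenerators r s ∨ g⁻¹ ∈ freeNilpotentGenerators r s) :
    IsLetter μ (pathHom r hs μ g) := by
  have h1 : ∀ i : Fin r, IsLetter μ (pathHom r hs μ (QuotientGroup.mk (FreeGroup.of i))) := by
    intro i
    rw [pathHom_mk, freePathHom, FreeGroup.lift_apply_of]
    split_ifs <;> simp [IsLetter]
  have h2 : ∀ {g : FreeNilpotentGroup r s}, g ∈ freeNilpotentGenerators r s →
      IsLetter μ (pathHom r hs μ g) := by
    rintro _ ⟨i, rfl | rfl⟩
    · exact h1 i
    · rw [map_inv]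
      exact (h1 i).inv
  rcases hg with hg | hg
  · exact h2 hg
  · simpa using (h2 hg).inv

end CostGroup

/-! ### Staircase rays and their Busemann functions -/

section FreeNilpotent

open CostGroup

theorem closure_freeNilpotentGenerators (r s : ℕ) :
    Subgroup.closure (freeNilpotentGenerators r s) = ⊤ := by
  refine (Subgroup.eq_top_iff' _).2 fun g => ?_
  obtain ⟨g, rfl⟩ := QuotientGroup.mk_surjective g
  induction g using FreeGroup.induction_on with
  | C1 => exact Subgroup.one_mem _
  | of i => exact Subgroup.subset_closure ⟨i, .inl rfl⟩
  | inv_of i h => exact Subgroup.inv_mem _ h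
  | mul g h hg hh => exact Subgroup.mul_mem _ hg hh

/-- The geodesic ray of the free nilpotent group that follows the line `x = μ y`. -/
noncomputable def staircaseRay {r : ℕ} (hr : 2 ≤ r) (s : ℕ) (μ : ℝ) : ℕ → FreeNilpotentGroup r s :=
  staircaseProd μ (QuotientGroup.mk (FreeGroup.of ⟨0, by omega⟩))
    (QuotientGroup.mk (FreeGroup.of ⟨1, by omega⟩))

variable {r s : ℕ}

theorem pathHom_staircaseRay (hr : 2 ≤ r) (hs : 3 ≤ s) (μ ν : ℝ) (n : ℕ) :
    pathHom r hs ν (staircaseRay hr s μ n) = staircaseProd μ stepRight (stepUp ν) n := by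
  rw [staircaseRay, map_staircaseProd, pathHom_mk, pathHom_mk, freePathHom,
    FreeGroup.lift_apply_of, FreeGroup.lift_apply_of]
  simp

/-- Each letter raises the height by at most 1, and the letters of the staircase raise it by exactly
1. -/
theorem isGeodesicRay_staircaseRay (hr : 2 ≤ r) (hs : 3 ≤ s) (μ : ℝ) :
    IsGeodesicRay (freeNilpotentGenerators r s) (staircaseRay hr s μ) := by
  have hS := closure_freeNilpotentGenerators r s
  intro m n hmn
  refine le_antisymm ?_ ?_
  · induction n, hmn using Nat.le_induction with
    | base =>
      have := wordLength_prod_le (S := freeNilpotentGenerators r s) (l := []) (by simp)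
      simpa [wordDist] using this
    | succ n hmn ih =>
      refine (wordDist_triangle hS _ (staircaseRay hr s μ n) _).trans ?_
      have h1 : wordDist (freeNilpotentGenerators r s) (staircaseRay hr s μ n)
          (staircaseRay hr s μ (n + 1)) ≤ 1 := by
        rw [wordDist, staircaseRay, staircaseProd, inv_mul_cancel_left,
          ← List.prod_singleton (x := ite _ _ _)]
        refine wordLength_prod_le fun a ha => .inl ?_
        rw [List.mem_singleton.1 ha]
        split_ifs
        exacts [⟨_, .inl rfl⟩, ⟨_, .inl rfl⟩]
      omega
  · obtain ⟨l, hl, hl', hl''⟩ := exists_list_length_eq_wordLength hS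
      ((staircaseRay hr s μ m)⁻¹ * staircaseRay hr s μ n)
    -- The height does not see the cost, so any slope would do.
    have h1 := height_prod_le (μ := 0) (l := l.map (pathHom r hs 0)) fun p hp => by
      obtain ⟨a, ha, rfl⟩ := List.mem_map.1 hp
      exact isLetter_pathHom hs 0 (hl a ha)
    have h2 := congrArg height (congrArg (pathHom r hs 0)
      (eq_mul_of_inv_mul_eq hl'.symm))
    rw [map_mul, height_mul, pathHom_staircaseRay, pathHom_staircaseRay, height_staircaseProd,
      height_staircaseProd] at h2
    rw [← map_list_prod, List.length_map, hl''] at h1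
    rw [wordDist]
    omega

theorem not_abs_busemannFunction_staircaseRay_sub_le (hr : 2 ≤ r) (hs : 3 ≤ s) {μ ν : ℝ} (hμ : 0 ≤ μ) (hμ1 : μ ≤ 1)
    (hν : 0 ≤ ν) (hνμ : ν < μ) (C : ℝ) :
    ¬ ∀ g, |busemannFunction (freeNilpotentGenerators r s) (staircaseRay hr s ν) g -
      busemannFunction (freeNilpotentGenerators r s) (staircaseRay hr s μ) g| ≤ C := by
  intro hC
  obtain ⟨E, hE⟩ := exists_nat_ge (C + 1)
  obtain ⟨A, hA⟩ : ∃ A : ℝ, A = 2 * (E + 1) := ⟨_, rfl⟩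
  have hE0 : (0 : ℝ) ≤ E := E.cast_nonneg
  obtain ⟨T, hT⟩ : ∃ T : ℝ, T = E * (2 * A ^ 2 + 2 * (A + 1) ^ 2) + 1 := ⟨_, rfl⟩
  have hT1 : 1 ≤ T := by
    rw [hT]
    exact le_add_of_nonneg_left (by positivity)
  -- So far along the `μ`-ray, the deviation from the `ν`-line exceeds the threshold `A + 1` by at
  -- least `T`, and `T ^ 2` outweighs the error constants.
  obtain ⟨k, hk⟩ := exists_nat_ge ((A + 1 + T + 3 / 2) / (μ - ν) * 2 + 1 / 2)
  have hdev : A + 1 + T ≤ deviation ν (staircase μ k) := by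
    refine le_trans ?_ (le_deviation_staircase_of_lt hμ hμ1 hνμ k)
    have h1 : (A + 1 + T + 3 / 2) / (μ - ν) ≤ ((k : ℝ) - 1 / 2) / 2 := by linarith
    rw [div_le_iff₀ (sub_pos.2 hνμ)] at h1
    linarith
  obtain ⟨n, l, hl, hln, hlen⟩ := exists_list_of_busemannFunction_sub_le
    (closure_freeNilpotentGenerators r s) (isGeodesicRay_staircaseRay hr hs μ) rfl
    (isGeodesicRay_staircaseRay hr hs ν) rfl hC k
  have h1 := congrArg (pathHom r hs ν) hln
  rw [map_mul, map_list_prod, pathHom_staircaseRay, pathHom_staircaseRay] at h1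
  have hdisp := congrArg disp h1
  rw [disp_mul, disp_staircaseProd, disp_staircaseProd] at hdisp
  have hheight := congrArg height h1
  rw [height_mul, height_staircaseProd, height_staircaseProd] at hheight
  have hexc := congrArg (fun p => excess (rowBound ν) p 0) h1
  rw [excess_mul, zero_add, disp_staircaseProd, excess_staircaseProd_self] at hexc
  have hexc0 := excess_staircaseProd_nonneg (isRowBound_rowBound ν) μ k
  have hlenE : l.length + k ≤ n + E := by
    have : (l.length : ℝ) + k ≤ n + E := by linarith
    exact_mod_cast this
  -- Taken with `e = E`, so the leading coefficient is 2; `hexc` and `hexc0` force the excess on the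
  -- right to be at most 0.
  have h2 := potential_le_excess hν (hνμ.le.trans hμ1) (isRowBound_rowBound ν) hA
    (l := l.map (pathHom r hs ν)) (v := staircase μ k) (fun p hp => by
      obtain ⟨a, ha, rfl⟩ := List.mem_map.1 hp
      exact isLetter_pathHom hs ν (hl a ha)) le_rfl
    (by rw [List.length_map]; omega)
    (by rw [hdisp]; linarith [deviation_staircase_le hν n])
  rw [sqAbove_of_le (u := -deviation ν (staircase μ k)) (by linarith),
    sqAbove_of_ge (by linarith)] at h2
  have h3 : T ≤ (deviation ν (staircase μ k) - (A + 1)) ^ 2 := by nlinarith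
  nlinarith

end FreeNilpotent

theorem mainTheorem3 (r s : ℕ) (hr : 2 ≤ r) (hs : 3 ≤ s) :
    ¬ (reducedBusemannPoints (freeNilpotentGenerators r s)).Countable := by
  intro hcount
  have hS := closure_freeNilpotentGenerators r s
  have hgeo := isGeodesicRay_staircaseRay hr hs
  let φ : Set.Icc (0 : ℝ) 1 → horoBoundary (freeNilpotentGenerators r s) := fun μ =>
    ⟨_, (hgeo μ).busemannFunction_mem_horoBoundary hS rfl⟩
  have hinj : Function.Injective fun μ => Quotient.mk (boundedDiffSetoid _) (φ μ) := by
    intro μ ν h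
    obtain ⟨C, hC⟩ := Quotient.exact h
    refine Subtype.ext (le_antisymm (not_lt.1 fun h' => ?_) (not_lt.1 fun h' => ?_))
    · refine not_abs_busemannFunction_staircaseRay_sub_le hr hs μ.2.1 μ.2.2 ν.2.1 h' C fun g => ?_
      rw [abs_sub_comm]
      exact hC g
    · exact not_abs_busemannFunction_staircaseRay_sub_le hr hs ν.2.1 ν.2.2 μ.2.1 h' C hC
  have hIcc := Set.MapsTo.countable_of_injOn (t := reducedBusemannPoints _)
    (fun μ _ => ⟨φ μ, ⟨_, hgeo μ, (hgeo μ).tendsto_busemannFunction hS rfl⟩, rfl⟩)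
    hinj.injOn (s := Set.univ) hcount
  exact absurd (Cardinal.Real.Icc_countable_iff.1 (Set.countable_coe_iff.1 (Set.countable_univ_iff.1 hIcc)))
    (by norm_num)
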